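/- Let $M$ be a smooth manifold of dimension $n=4$, let $\mathcal{E}[w]:=\big((\Lambda^{n}TM)^{\otimes 2}\big)^{w/2n}$ be the bundle of conformal densities of weight $w\in\mathbb{R}$, and for a smooth Riemannian metric $g$ on $M$ let $\boldsymbol{g}_{ab}:=\sigma_g^{2}g_{ab}$ be the conformal metric, of weight $2$, where $\sigma_g:=(\mathrm{vol}_g^{-2})^{1/2n}$ is the positive section of $\mathcal{E}[1]$ determined by $g$; $\boldsymbol{g}_{ab}$ depends only on the conformal class of $g$. All indices are raised with the inverse $\boldsymbol{g}^{ab}$, of weight $-2$. Let $\nabla$ be the Levi-Civita connection of $g$, acting also on densities, let $R_{ab}{}^c{}_d$ be its curvature, $[\nabla_a,\nabla_b]X^c=R_{ab}{}^c{}_dX^d$, let $R_{bc}=R_{ab}{}^a{}_c$ be its Ricci tensor and $R$ its scalar curvature with respect to $g$, let $$P_{ab}=\tfrac{1}{n-2}\Big(R_{ab}-\tfrac{R}{2(n-1)}g_{ab}\Big)$$ be the Schouten tensor, and let $J:=\boldsymbol{g}^{ab}P_{ab}$. For a closed smooth 1-form $v_a$ let $Q_1^g v_a$ be the 1-form of conformal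 weight $-2$ $$Q_1^g v_a=-\nabla_a\nabla^b v_b-4P_a{}^b v_b+2J v_a .$$ Then for every smooth Riemannian metric $g$ on $M$, every $\Upsilon\in C^\infty(M)$ and every closed smooth 1-form $v_a$ on $M$, the metric $\hat g=e^{2\Upsilon}g$ satisfies $$Q_1^{\hat g}v_a=Q_1^g v_a+4\nabla^b\nabla_{[a}(\Upsilon v_{b]}),$$ an equality of 1-forms of weight $-2$, where $\nabla$ on the right-hand side is the Levi-Civita connection of $g$ and $\nabla_{[a}u_{b]}=\tfrac12(\nabla_a u_b-\nabla_b u_a)$. -/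

import Mathlib

open Bundle Manifold
open scoped ContDiff

noncomputable section

namespace ConformalQ

/-- The model space of an `n`-dimensional manifold. -/
abbrev Model (n : ℕ) : Type := EuclideanSpace ℝ (Fin n)

/-! ### Smooth objects on a manifold -/

section Manifold

variable (n : ℕ) (M : Type*) [TopologicalSpace M] [ChartedSpace (Model n) M]
  [IsManifold (𝓡 n) ∞ M]

/-- Smooth Riemannian metrics on an `n`-manifold. -/
abbrev Metric : Type _ :=
  ContMDiffRiemannianMetric (𝓡 n) ∞ (Model n) (fun x : M ↦ TangentSpace (𝓡 n) x)

/-- Smooth 1-forms, i.e. smooth sections of the cotangent bundle. -/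
abbrev OneForm : Type _ :=
  ContMDiffSection (𝓡 n) (Model n →L[ℝ] ℝ) ∞ (fun x : M ↦ TangentSpace (𝓡 n) x →L[ℝ] ℝ)

variable {n M}

set_option synthInstance.maxHeartbeats 400000 in
/-- The conformally related metric `e^{2Υ} g`. -/
def conformalChange (g : Metric n M) (Υ : C^∞⟮𝓡 n, M; ℝ⟯) : Metric n M where
  inner x := Real.exp (2 * Υ x) • g.inner x
  symm x v w := by simp [g.symm x v w]
  pos x v hv := by
    have := g.pos x v hv
    simp only [smul_apply, smul_eq_mul]
    positivity
  isVonNBounded x := by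
    refine ((g.isVonNBounded x).image ((Real.exp (Υ x))⁻¹ •
      ContinuousLinearMap.id ℝ (TangentSpace (𝓡 n) x))).subset fun v hv ↦ ?_
    refine ⟨Real.exp (Υ x) • v, ?_, ?_⟩
    · have h : Real.exp (2 * Υ x) = Real.exp (Υ x) * Real.exp (Υ x) := by
        rw [← Real.exp_add]; ring_nf
      simpa [h, mul_assoc] using hv
    · simp [smul_smul]
  contMDiff := by
    have h : ContMDiff (𝓡 n) 𝓘(ℝ, ℝ) ∞ fun x ↦ Real.exp (2 * Υ x) :=
      Real.contDiff_exp.contMDiff.comp (contMDiff_const.mul Υ.contMDiff)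
    exact h.smul_section g.contMDiff

end Manifold

/-! ### Components in a chart -/

section Components

variable {n : ℕ} {M : Type*} [TopologicalSpace M] [ChartedSpace (Model n) M]
  [IsManifold (𝓡 n) ∞ M]

/-- The coordinate vector field `∂_i` of the chart `φ`, at the point with coordinates `y`. -/
def coordVector (φ : OpenPartialHomeomorph M (Model n)) (i : Fin n) (y : Model n) :
    TangentSpace (𝓡 n) (φ.symm y) :=
  mfderiv (𝓡 n) (𝓡 n) φ.symm y (EuclideanSpace.single i (1 : ℝ))

/-- The components `g_{ij}` of a metric in the chart `φ`. -/
def metricComp (φ : OpenPartialHomeomorph M (Model n)) (g : Metric n M) (y : Model n) :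
    Matrix (Fin n) (Fin n) ℝ :=
  Matrix.of fun i j ↦ g.inner (φ.symm y) (coordVector φ i y) (coordVector φ j y)

/-- The components `v_i` of a 1-form in the chart `φ`. -/
def formComp (φ : OpenPartialHomeomorph M (Model n)) (v : OneForm n M) (i : Fin n)
    (y : Model n) : ℝ :=
  v (φ.symm y) (coordVector φ i y)

end Components

/-! ### Tensor calculus in coordinates

`G` is the matrix of components `g_{ij}` of a metric, as a function of the coordinates. -/

section Coordinates

variable {n : ℕ}

/-- The partial derivative `∂_i f`. -/
def pd (i : Fin n) (f : Model n → ℝ) (y : Model n) : ℝ :=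
  fderiv ℝ f y (EuclideanSpace.single i (1 : ℝ))

/-- The Christoffel symbol `Γ^c_{ab}` of the Levi-Civita connection. -/
def christoffel (G : Model n → Matrix (Fin n) (Fin n) ℝ) (c a b : Fin n) (y : Model n) : ℝ :=
  (1 / 2) * ∑ d, (G y)⁻¹ c d *
    (pd a (fun z ↦ G z b d) y + pd b (fun z ↦ G z a d) y - pd d (fun z ↦ G z a b) y)

/-- `R_{ab}{}^c{}_d`, with the convention `[∇_a, ∇_b] X^c = R_{ab}{}^c{}_d X^d`. -/
def riemann (G : Model n → Matrix (Fin n) (Fin n) ℝ) (a b c d : Fin n) (y : Model n) : ℝ :=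
  pd a (christoffel G c b d) y - pd b (christoffel G c a d) y
    + ∑ e, (christoffel G c a e y * christoffel G e b d y
      - christoffel G c b e y * christoffel G e a d y)

/-- The Ricci tensor `R_{bc} = R_{ab}{}^a{}_c`. -/
def ricci (G : Model n → Matrix (Fin n) (Fin n) ℝ) (b c : Fin n) (y : Model n) : ℝ :=
  ∑ a, riemann G a b a c y

/-- The scalar curvature `R = g^{ab} R_{ab}`. -/
def scalarCurvature (G : Model n → Matrix (Fin n) (Fin n) ℝ) (y : Model n) : ℝ :=
  ∑ a, ∑ b, (G y)⁻¹ a b * ricci G a b y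

/-- The Schouten tensor `P_{ab} = (R_{ab} - R g_{ab} / (2 (n - 1))) / (n - 2)` (for `n ≥ 3`). -/
def schouten (G : Model n → Matrix (Fin n) (Fin n) ℝ) (a b : Fin n) (y : Model n) : ℝ :=
  (1 / ((n : ℝ) - 2)) * (ricci G a b y - scalarCurvature G y / (2 * ((n : ℝ) - 1)) * G y a b)

/-- The covariant derivative `∇_a u_b` of a 1-form. -/
def covForm (G : Model n → Matrix (Fin n) (Fin n) ℝ) (u : Fin n → Model n → ℝ)
    (a b : Fin n) (y : Model n) : ℝ :=
  pd a (u b) y - ∑ c, christoffel G c a b y * u c y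

/-- The covariant derivative `∇_c T_{ab}` of a covariant 2-tensor. -/
def covTwoTensor (G : Model n → Matrix (Fin n) (Fin n) ℝ) (T : Fin n → Fin n → Model n → ℝ)
    (c a b : Fin n) (y : Model n) : ℝ :=
  pd c (T a b) y - ∑ d, christoffel G d c a y * T d b y - ∑ d, christoffel G d c b y * T a d y

/-! Conformal densities. A section of `E[w] = ((Λⁿ TM)^{⊗ 2})^{w / 2n}` is represented in a chart
by its coefficient with respect to the local frame `((∂_1 ∧ ⋯ ∧ ∂_n)^{⊗ 2})^{w / 2n}`, and a
tensor of weight `w`, i.e. one with values in `E[w]`, by its components with respect to this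
frame tensored with the coordinate frame. -/

/-- The Levi-Civita covariant derivative `∇_a f` of a density `f` of weight `w`. On the frame of
`Λⁿ TM` the connection is `∇_a (∂_1 ∧ ⋯ ∧ ∂_n) = Γ^b_{ab} (∂_1 ∧ ⋯ ∧ ∂_n)`. -/
def covDensity (G : Model n → Matrix (Fin n) (Fin n) ℝ) (w : ℝ) (f : Model n → ℝ)
    (a : Fin n) (y : Model n) : ℝ :=
  pd a f y + (w / n) * (∑ b, christoffel G b a b y) * f y

/-- The scale `σ`, a positive density of weight `1`, that belongs to the metric `g`: the root
`(vol_g^{-2})^{1 / 2n}` of the section `vol_g^{-2}` of `(Λⁿ TM)^{⊗ 2}`. -/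
def scale (G : Model n → Matrix (Fin n) (Fin n) ℝ) (y : Model n) : ℝ :=
  (G y).det ^ (-(1 / (2 * (n : ℝ))))

/-- The conformal metric `σ² g_{ab}`, of weight `2`. -/
def confMetric (G : Model n → Matrix (Fin n) (Fin n) ℝ) (y : Model n) :
    Matrix (Fin n) (Fin n) ℝ :=
  scale G y ^ 2 • G y

/-- The inverse of the conformal metric, of weight `-2`. All indices are raised with it. -/
def confInv (G : Model n → Matrix (Fin n) (Fin n) ℝ) (y : Model n) :
    Matrix (Fin n) (Fin n) ℝ :=
  (confMetric G y)⁻¹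

/-- The divergence `∇^b u_b` of a 1-form, a density of weight `-2`. -/
def divForm (G : Model n → Matrix (Fin n) (Fin n) ℝ) (u : Fin n → Model n → ℝ)
    (y : Model n) : ℝ :=
  ∑ b, ∑ c, confInv G y b c * covForm G u c b y

/-- The divergence `∇^b T_{ab}` of a covariant 2-tensor, a 1-form of weight `-2`. -/
def divTwoTensor (G : Model n → Matrix (Fin n) (Fin n) ℝ) (T : Fin n → Fin n → Model n → ℝ)
    (a : Fin n) (y : Model n) : ℝ :=
  ∑ b, ∑ c, confInv G y b c * covTwoTensor G T c a b y

/-- The skew part `∇_{[a} u_{b]}` of the covariant derivative of a 1-form. -/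
def skewCovForm (G : Model n → Matrix (Fin n) (Fin n) ℝ) (u : Fin n → Model n → ℝ)
    (a b : Fin n) (y : Model n) : ℝ :=
  (1 / 2) * (covForm G u a b y - covForm G u b a y)

/-- The trace `J` of the Schouten tensor, a density of weight `-2`. -/
def schoutenTrace (G : Model n → Matrix (Fin n) (Fin n) ℝ) (y : Model n) : ℝ :=
  ∑ a, ∑ b, confInv G y a b * schouten G a b y

/-- `-∇_a ∇^b u_b - 4 P_a{}^b u_b + 2 J u_a`, a 1-form of weight `-2`. -/
def qOne (G : Model n → Matrix (Fin n) (Fin n) ℝ) (u : Fin n → Model n → ℝ)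
    (a : Fin n) (y : Model n) : ℝ :=
  -covDensity G (-2) (divForm G u) a y
    - 4 * ∑ b, (∑ c, schouten G a c y * confInv G y c b) * u b y
    + 2 * schoutenTrace G y * u a y

end Coordinates

/-! ### The objects of the statement -/

section Manifold

variable {n : ℕ} {M : Type*} [TopologicalSpace M] [ChartedSpace (Model n) M]
  [IsManifold (𝓡 n) ∞ M]

/-- A 1-form `v` is closed: `dv = 0`, i.e. `∂_i v_j = ∂_j v_i` in all smooth charts. -/
def OneForm.IsClosed (v : OneForm n M) : Prop :=
  ∀ φ ∈ IsManifold.maximalAtlas (𝓡 n) ∞ M, ∀ y ∈ φ.target, ∀ i j : Fin n,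
    pd i (formComp φ v j) y = pd j (formComp φ v i) y

/-- The components in the chart `φ` of `Q₁^g v`, a 1-form of weight `-2` when `n = 4`. -/
def Q₁ (g : Metric n M) (v : OneForm n M) (φ : OpenPartialHomeomorph M (Model n))
    (a : Fin n) (y : Model n) : ℝ :=
  qOne (metricComp φ g) (formComp φ v) a y

/-- The components in the chart `φ` of `∇^b ∇_{[a} (Υ v_{b]})`, with `∇` the Levi-Civita connection
of `g`. -/
def divSkew (g : Metric n M) (Υ : C^∞⟮𝓡 n, M; ℝ⟯) (v : OneForm n M)
    (φ : OpenPartialHomeomorph M (Model n)) (a : Fin n) (y : Model n) : ℝ :=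
  divTwoTensor (metricComp φ g)
    (skewCovForm (metricComp φ g) fun b z ↦ Υ (φ.symm z) * formComp φ v b z) a y

end Manifold

end ConformalQ

end

/-! The identity is local and tensorial, so it is checked in the components of one smooth chart.
There, write Υ_a for ∂_a Υ. The Levi-Civita connection changes by the tensor δ^c_b Υ_a + δ^c_a Υ_b -
Υ^c g_ab (`christoffel_rescale`), and every other variation follows from this.

In dimension 4 the divergence of v gains 2Υ^b v_b (`divForm_rescale`), and the derivative of a
density f of weight -2 gains -2Υ_a f (`covDensity_rescale`). The Schouten tensor gains -∇_aΥ_b +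
Υ_aΥ_b - ½|Υ|²g_ab (`schouten_rescale`, resting on `ricci_rescale`). The inverse conformal metric
does not change (`confInv_rescale`).

In the variation of Q₁ the terms quadratic in Υ cancel: 4Υ_aΥ^b v_b from the divergence term against
-4Υ_aΥ^b v_b from P, and 2|Υ|²v_a from P against -2|Υ|²v_a from J. The linear terms, expanded by the
Leibniz rule, leave 2(v_b∇^bΥ_a + Υ_a∇^b v_b - v_a∇^bΥ_b - Υ^b∇_a v_b). Since v is closed,
∇_{[a}(Υv_{b]}) = Υ_{[a}v_{b]} and ∇_b v_a = ∇_a v_b, so this is 4∇^b∇_{[a}(Υv_{b]})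
(`divTwoTensor_skewCovForm`). -/

noncomputable section

namespace ConformalQ

/-! ### Smoothness, symmetry and positivity of components in a smooth chart. -/

section Charts

variable {n : ℕ} {M : Type*} [TopologicalSpace M] [ChartedSpace (Model n) M]
  [IsManifold (𝓡 n) ∞ M] {φ : OpenPartialHomeomorph M (Model n)}

/-- The coordinate vector fields of a smooth chart are smooth. -/
lemma contMDiffOn_coordVector (hφ : φ ∈ IsManifold.maximalAtlas (𝓡 n) ∞ M) (i : Fin n) :
    ContMDiffOn (𝓡 n) (𝓡 n).tangent ∞
      (fun y ↦ (TotalSpace.mk' (Model n) (φ.symm y) (coordVector φ i y) : TangentBundle (𝓡 n) M))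
      φ.target := by
  have h1 : ContMDiffOn (𝓡 n) (𝓡 n) ∞ φ.symm φ.target := contMDiffOn_symm_of_mem_maximalAtlas hφ
  have h2 := h1.contMDiffOn_tangentMapWithin (m := ∞) (by simp) φ.open_target.uniqueMDiffOn
  -- The coordinate field is the tangent map of the inverse chart applied to a constant field on the
  -- model space.
  have h3 : ContMDiff (𝓡 n) (𝓡 n).tangent ∞
      (fun y : Model n ↦ (TotalSpace.mk' (Model n) y (EuclideanSpace.single i (1 : ℝ)) :
        TangentBundle (𝓡 n) (Model n))) := by
    exact contMDiff_vectorSpace_iff_contDiff.2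
      (contDiff_const (c := (EuclideanSpace.single i (1 : ℝ) : Model n)))
  refine (h2.comp h3.contMDiffOn fun y hy ↦ hy).congr fun y hy ↦ ?_
  simp only [coordVector, Function.comp, tangentMapWithin]
  rw [mfderivWithin_of_isOpen φ.open_target hy]

lemma contDiffOn_metricComp (hφ : φ ∈ IsManifold.maximalAtlas (𝓡 n) ∞ M) (g : Metric n M)
    (i j : Fin n) : ContDiffOn ℝ ∞ (fun y ↦ metricComp φ g y i j) φ.target := by
  have h1 : ContMDiffOn (𝓡 n) (𝓡 n) ∞ φ.symm φ.target := contMDiffOn_symm_of_mem_maximalAtlas hφ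
  rw [← contMDiffOn_iff_contDiffOn]
  intro y hy
  have h := ((g.contMDiff.comp_contMDiffOn h1) y hy).clm_bundle_apply₂
    (E₃ := Bundle.Trivial M ℝ) (F₃ := ℝ) (v := fun y ↦ coordVector φ i y)
    (w := fun y ↦ coordVector φ j y)
    (contMDiffOn_coordVector hφ i y hy) (contMDiffOn_coordVector hφ j y hy)
  -- The values lie in a trivial line bundle, so smoothness of the section includes that of its
  -- fibre coordinate, the component.
  rw [Bundle.contMDiffWithinAt_totalSpace] at h
  exact h.2

lemma contDiffOn_formComp (hφ : φ ∈ IsManifold.maximalAtlas (𝓡 n) ∞ M) (v : OneForm n M)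
    (i : Fin n) : ContDiffOn ℝ ∞ (formComp φ v i) φ.target := by
  have h1 : ContMDiffOn (𝓡 n) (𝓡 n) ∞ φ.symm φ.target := contMDiffOn_symm_of_mem_maximalAtlas hφ
  rw [← contMDiffOn_iff_contDiffOn]
  intro y hy
  have h := ((v.contMDiff.comp_contMDiffOn h1) y hy).clm_bundle_apply
    (E₂ := Bundle.Trivial M ℝ) (F₂ := ℝ) (v := fun y ↦ coordVector φ i y)
    (contMDiffOn_coordVector hφ i y hy)
  rw [Bundle.contMDiffWithinAt_totalSpace] at h
  exact h.2

omit [IsManifold (𝓡 n) ∞ M] in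
lemma contDiffOn_comp_symm (hφ : φ ∈ IsManifold.maximalAtlas (𝓡 n) ∞ M) (f : C^∞⟮𝓡 n, M; ℝ⟯) :
    ContDiffOn ℝ ∞ (fun y ↦ f (φ.symm y)) φ.target := by
  rw [← contMDiffOn_iff_contDiffOn]
  exact f.contMDiff.comp_contMDiffOn (contMDiffOn_symm_of_mem_maximalAtlas hφ)

lemma metricComp_symm (φ : OpenPartialHomeomorph M (Model n)) (g : Metric n M) (y : Model n)
    (i j : Fin n) : metricComp φ g y i j = metricComp φ g y j i :=
  g.symm _ _ _

lemma metricComp_conformalChange (φ : OpenPartialHomeomorph M (Model n)) (g : Metric n M)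
    (Υ : C^∞⟮𝓡 n, M; ℝ⟯) (y : Model n) :
    metricComp φ (conformalChange g Υ) y =
      Real.exp (2 * Υ (φ.symm y)) • metricComp φ g y := by
  ext i j
  rfl

/-- The quadratic form of the matrix is the pullback of g under the derivative of the inverse chart,
and that derivative is injective. -/
lemma metricComp_posDef (hφ : φ ∈ IsManifold.maximalAtlas (𝓡 n) ∞ M) (g : Metric n M)
    {y : Model n} (hy : y ∈ φ.target) : (metricComp φ g y).PosDef := by
  have hd : φ.MDifferentiable (𝓡 n) (𝓡 n) :=
    ⟨(contMDiffOn_of_mem_maximalAtlas hφ).mdifferentiableOn (by simp),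
      (contMDiffOn_symm_of_mem_maximalAtlas hφ).mdifferentiableOn (by simp)⟩
  have hinj := hd.symm.mfderiv_injective (x := y) hy
  refine Matrix.PosDef.of_dotProduct_mulVec_pos ?_ fun x hx ↦ ?_
  · ext i j
    exact metricComp_symm φ g y j i
  · let D : Model n →L[ℝ] Model n := mfderiv (𝓡 n) (𝓡 n) φ.symm y
    let B : Model n →L[ℝ] Model n →L[ℝ] ℝ := g.inner (φ.symm y)
    have hB (i j : Fin n) : metricComp φ g y i j =
      B (D (EuclideanSpace.single j (1 : ℝ))) (D (EuclideanSpace.single i (1 : ℝ))) :=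
      metricComp_symm φ g y i j
    have hw : WithLp.toLp 2 x = ∑ i, x i • EuclideanSpace.single i (1 : ℝ) := by
      ext j
      simp [Pi.single_apply]
    have hne : D (WithLp.toLp 2 x) ≠ 0 := fun h ↦ hx (by
      have : WithLp.toLp 2 x = (0 : Model n) := hinj (h.trans (map_zero D).symm)
      simpa using this)
    have hpos : 0 < B (D (WithLp.toLp 2 x)) (D (WithLp.toLp 2 x)) := g.pos _ _ hne
    rw [hw] at hpos
    simpa [dotProduct, Matrix.mulVec, hB, Finset.mul_sum, mul_comm, mul_left_comm] using hpos

end Charts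

/-! ### Calculus of partial derivatives. -/

section PartialDerivatives

variable {n : ℕ} {f h : Model n → ℝ} {y : Model n}

lemma pd_congr (hfh : f =ᶠ[nhds y] h) (a : Fin n) : pd a f y = pd a h y := by
  rw [pd, pd, hfh.fderiv_eq]

lemma pd_congr_on {S : Set (Model n)} (hS : IsOpen S) (hfh : ∀ z ∈ S, f z = h z) (hy : y ∈ S)
    (a : Fin n) : pd a f y = pd a h y :=
  pd_congr (Filter.eventuallyEq_of_mem (hS.mem_nhds hy) hfh) a

@[simp] lemma pd_const (a : Fin n) (c : ℝ) : pd a (fun _ ↦ c) y = 0 := by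
  simp [pd]

lemma pd_add (hf : DifferentiableAt ℝ f y) (hh : DifferentiableAt ℝ h y) (a : Fin n) :
    pd a (fun z ↦ f z + h z) y = pd a f y + pd a h y := by
  simp [pd, fderiv_fun_add hf hh]

lemma pd_sub (hf : DifferentiableAt ℝ f y) (hh : DifferentiableAt ℝ h y) (a : Fin n) :
    pd a (fun z ↦ f z - h z) y = pd a f y - pd a h y := by
  simp [pd, fderiv_fun_sub hf hh]

lemma pd_mul (hf : DifferentiableAt ℝ f y) (hh : DifferentiableAt ℝ h y) (a : Fin n) :
    pd a (fun z ↦ f z * h z) y = pd a f y * h y + f y * pd a h y := by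
  simp [pd, fderiv_fun_mul hf hh]
  ring

lemma pd_const_mul (hf : DifferentiableAt ℝ f y) (c : ℝ) (a : Fin n) :
    pd a (fun z ↦ c * f z) y = c * pd a f y := by
  simp [pd, fderiv_const_mul hf]

lemma pd_sum {ι : Type*} (s : Finset ι) {F : ι → Model n → ℝ}
    (hF : ∀ i ∈ s, DifferentiableAt ℝ (F i) y) (a : Fin n) :
    pd a (fun z ↦ ∑ i ∈ s, F i z) y = ∑ i ∈ s, pd a (F i) y := by
  simp [pd, fderiv_fun_sum hF]

lemma contDiffOn_pd {S : Set (Model n)} (hS : IsOpen S) (hf : ContDiffOn ℝ ∞ f S) (a : Fin n) :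
    ContDiffOn ℝ ∞ (pd a f) S :=
  (hf.fderiv_of_isOpen hS (by simp)).clm_apply contDiffOn_const

lemma pd_comm {S : Set (Model n)} (hS : IsOpen S) (hf : ContDiffOn ℝ ∞ f S) (hy : y ∈ S)
    (a b : Fin n) : pd a (pd b f) y = pd b (pd a f) y := by
  have hc : ContDiffAt ℝ ∞ f y := hf.contDiffAt (hS.mem_nhds hy)
  have hd : DifferentiableAt ℝ (fderiv ℝ f) y :=
    (hc.fderiv_right (m := 1) (by
      norm_num
      exact ENat.LEInfty.out)).differentiableAt (by simp)
  have hs : IsSymmSndFDerivAt ℝ f y := hc.isSymmSndFDerivAt (by simpa using ENat.LEInfty.out)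
  have key (a b : Fin n) : pd a (pd b f) y =
      fderiv ℝ (fderiv ℝ f) y (EuclideanSpace.single a 1) (EuclideanSpace.single b 1) := by
    unfold pd
    rw [fderiv_clm_apply hd (differentiableAt_const _)]
    simp
  rw [key, key, hs.eq]

end PartialDerivatives

/-! ### Determinant, inverse and Christoffel symbols of a metric. -/

section Matrices

variable {n : ℕ} {S : Set (Model n)} {G : Model n → Matrix (Fin n) (Fin n) ℝ} {y : Model n}

/-- `G` is the matrix of components of a smooth Riemannian metric on the open set `S`. -/
structure IsMetricOn (G : Model n → Matrix (Fin n) (Fin n) ℝ) (S : Set (Model n)) : Prop where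
  isOpen : IsOpen S
  contDiffOn (i j : Fin n) : ContDiffOn ℝ ∞ (fun z ↦ G z i j) S
  posDef : ∀ z ∈ S, (G z).PosDef

lemma contDiffOn_det (hG : ∀ i j, ContDiffOn ℝ ∞ (fun z ↦ G z i j) S) :
    ContDiffOn ℝ ∞ (fun z ↦ (G z).det) S := by
  simp only [Matrix.det_apply']
  exact ContDiffOn.sum fun σ _ ↦ contDiffOn_const.mul (contDiffOn_prod fun i _ ↦ hG _ _)

/-- The logarithmic derivative of a determinant. -/
lemma pd_det (hG : ∀ i j, DifferentiableAt ℝ (fun z ↦ G z i j) y) (hdet : (G y).det ≠ 0)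
    (a : Fin n) : pd a (fun z ↦ (G z).det) y =
      (G y).det * ((G y)⁻¹ * Matrix.of fun i j ↦ pd a (fun z ↦ G z i j) y).trace := by
  let D : ContinuousMultilinearMap ℝ (fun _ : Fin n ↦ Fin n → ℝ) ℝ :=
    { (Matrix.detRowAlternating (R := ℝ) (n := Fin n)).toMultilinearMap with
      cont := Continuous.matrix_det continuous_id }
  have hG' : HasFDerivAt (fun z i j ↦ G z i j)
      (ContinuousLinearMap.pi fun i ↦ ContinuousLinearMap.pi fun j ↦
        fderiv ℝ (fun z ↦ G z i j) y) y :=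
    hasFDerivAt_pi.2 fun i ↦ hasFDerivAt_pi.2 fun j ↦ (hG i j).hasFDerivAt
  have h := (D.hasFDerivAt (fun i j ↦ G y i j)).comp y hG'
  have hD (A : Fin n → Fin n → ℝ) : D A = Matrix.det (Matrix.of A) := rfl
  have h' : fderiv ℝ (fun z ↦ (G z).det) y = _ := h.fderiv
  -- As a multilinear map in the rows, det has as derivative the sum over i of det with row i
  -- replaced by its derivative; Cramer's rule turns each summand into a diagonal entry of dG times
  -- the adjugate.
  rw [pd, h', ContinuousLinearMap.comp_apply, ContinuousMultilinearMap.linearDeriv_apply,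
    Matrix.inv_def, Ring.inverse_eq_inv', Matrix.smul_mul, Matrix.trace_smul, smul_eq_mul,
    mul_inv_cancel_left₀ hdet, Matrix.trace_mul_comm, Matrix.trace]
  refine Finset.sum_congr rfl fun i _ ↦ ?_
  have hu : Matrix.of (Function.update (fun i j ↦ G y i j) i
      fun j ↦ pd a (fun z ↦ G z i j) y) =
      (G y).updateRow i fun j ↦ pd a (fun z ↦ G z i j) y := rfl
  refine (congrArg Matrix.det hu).trans ?_
  rw [← Matrix.cramer_transpose_apply, Matrix.cramer_eq_adjugate_mulVec,
    ← Matrix.adjugate_transpose, Matrix.diag, Matrix.mul_apply]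
  simp [Matrix.mulVec, dotProduct, mul_comm]

namespace IsMetricOn

variable (hG : IsMetricOn G S)
include hG

lemma differentiableAt (hy : y ∈ S) (i j : Fin n) : DifferentiableAt ℝ (fun z ↦ G z i j) y :=
  ((hG.contDiffOn i j).contDiffAt (hG.isOpen.mem_nhds hy)).differentiableAt (by simp)

lemma det_pos (hy : y ∈ S) : 0 < (G y).det := (hG.posDef y hy).det_pos

lemma isUnit_det (hy : y ∈ S) : IsUnit (G y).det := (hG.det_pos hy).ne'.isUnit

lemma transpose_eq (hy : y ∈ S) : (G y).transpose = G y := by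
  simpa using (hG.posDef y hy).isHermitian.eq

lemma symm (hy : y ∈ S) (i j : Fin n) : G y i j = G y j i :=
  congrFun (congrFun (hG.transpose_eq hy) j) i

lemma inv_transpose_eq (hy : y ∈ S) : ((G y)⁻¹).transpose = (G y)⁻¹ := by
  rw [Matrix.transpose_nonsing_inv, hG.transpose_eq hy]

lemma inv_symm (hy : y ∈ S) (i j : Fin n) : (G y)⁻¹ i j = (G y)⁻¹ j i :=
  congrFun (congrFun (hG.inv_transpose_eq hy) j) i

lemma contDiffOn_inv (i j : Fin n) : ContDiffOn ℝ ∞ (fun z ↦ (G z)⁻¹ i j) S := by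
  simp only [Matrix.inv_def, Ring.inverse_eq_inv', Matrix.smul_apply, smul_eq_mul,
    Matrix.adjugate_apply]
  refine ((contDiffOn_det hG.contDiffOn).inv fun z hz ↦ (hG.det_pos hz).ne').mul
    (contDiffOn_det fun k l ↦ ?_)
  by_cases hk : k = j
  · subst hk
    simpa using contDiffOn_const
  · simpa [Matrix.updateRow_ne hk] using hG.contDiffOn k l

lemma differentiableAt_inv (hy : y ∈ S) (i j : Fin n) :
    DifferentiableAt ℝ (fun z ↦ (G z)⁻¹ i j) y :=
  ((hG.contDiffOn_inv i j).contDiffAt (hG.isOpen.mem_nhds hy)).differentiableAt (by simp)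

lemma contDiffOn_christoffel (c a b : Fin n) : ContDiffOn ℝ ∞ (christoffel G c a b) S :=
  contDiffOn_const.mul <| ContDiffOn.sum fun d _ ↦ (hG.contDiffOn_inv c d).mul <|
    ((contDiffOn_pd hG.isOpen (hG.contDiffOn b d) a).add
      (contDiffOn_pd hG.isOpen (hG.contDiffOn a d) b)).sub
        (contDiffOn_pd hG.isOpen (hG.contDiffOn a b) d)

lemma sum_inv_mul (hy : y ∈ S) (i j : Fin n) :
    ∑ k, (G y)⁻¹ i k * G y k j = if i = j then 1 else 0 := by
  rw [← Matrix.one_apply, ← Matrix.nonsing_inv_mul _ (hG.isUnit_det hy), Matrix.mul_apply]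

lemma sum_mul_inv (hy : y ∈ S) (i j : Fin n) :
    ∑ k, G y i k * (G y)⁻¹ k j = if i = j then 1 else 0 := by
  rw [← Matrix.one_apply, ← Matrix.mul_nonsing_inv _ (hG.isUnit_det hy), Matrix.mul_apply]

lemma christoffel_symm (hy : y ∈ S) (c a b : Fin n) :
    christoffel G c a b y = christoffel G c b a y := by
  simp only [christoffel]
  congr 1
  refine Finset.sum_congr rfl fun d _ ↦ ?_
  rw [pd_congr_on hG.isOpen (fun z hz ↦ hG.symm hz a b) hy]
  ring

/-- Lowering the upper index cancels the inverse metric and leaves the Christoffel symbols of the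
first kind. -/
lemma sum_mul_christoffel (hy : y ∈ S) (e a b : Fin n) :
    ∑ c, G y e c * christoffel G c a b y =
      1 / 2 * (pd a (fun z ↦ G z b e) y + pd b (fun z ↦ G z a e) y - pd e (fun z ↦ G z a b) y) := by
  simp only [christoffel, Finset.mul_sum]
  rw [Finset.sum_comm]
  have (d : Fin n) (X : ℝ) : ∑ c, G y e c * (1 / 2 * ((G y)⁻¹ c d * X)) =
      (∑ c, G y e c * (G y)⁻¹ c d) * (1 / 2 * X) := by
    rw [Finset.sum_mul]
    exact Finset.sum_congr rfl fun c _ ↦ by ring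
  simp only [this, hG.sum_mul_inv hy, ite_mul, one_mul, zero_mul, Finset.sum_ite_eq,
    Finset.mem_univ, if_true]

/-- The Levi-Civita connection is metric. -/
lemma pd_metric (hy : y ∈ S) (a b c : Fin n) : pd a (fun z ↦ G z b c) y =
    ∑ e, christoffel G e a b y * G y e c + ∑ e, G y b e * christoffel G e a c y := by
  have h : ∑ e, christoffel G e a b y * G y e c = ∑ e, G y c e * christoffel G e a b y :=
    Finset.sum_congr rfl fun e _ ↦ by rw [hG.symm hy e c, mul_comm]
  rw [h, hG.sum_mul_christoffel hy, hG.sum_mul_christoffel hy,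
    pd_congr_on hG.isOpen (fun z hz ↦ hG.symm hz c b) hy]
  ring

/-- Metric compatibility passes to the inverse by differentiating G⁻¹G = 1 and multiplying by G⁻¹ on
the right. -/
lemma pd_inv (hy : y ∈ S) (a b c : Fin n) : pd a (fun z ↦ (G z)⁻¹ b c) y =
    - ∑ e, christoffel G b a e y * (G y)⁻¹ e c - ∑ e, (G y)⁻¹ b e * christoffel G c a e y := by
  let Γ : Matrix (Fin n) (Fin n) ℝ := Matrix.of fun i j ↦ christoffel G i a j y
  let dG : Matrix (Fin n) (Fin n) ℝ := Matrix.of fun i j ↦ pd a (fun z ↦ G z i j) y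
  let dH : Matrix (Fin n) (Fin n) ℝ := Matrix.of fun i j ↦ pd a (fun z ↦ (G z)⁻¹ i j) y
  have hdG : dG = Γ.transpose * G y + G y * Γ := by
    ext i j
    simp [dG, Γ, Matrix.mul_apply, hG.pd_metric hy]
  have h0 : dH * G y + (G y)⁻¹ * dG = 0 := by
    ext i j
    have h : pd a (fun z ↦ ∑ k, (G z)⁻¹ i k * G z k j) y = 0 := by
      rw [pd_congr_on hG.isOpen (fun z hz ↦ hG.sum_inv_mul hz i j) hy, pd_const]
    rw [pd_sum _ fun k _ ↦
      (hG.differentiableAt_inv hy i k).fun_mul (hG.differentiableAt hy k j)] at h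
    simp only [pd_mul (hG.differentiableAt_inv hy i _) (hG.differentiableAt hy _ j),
      Finset.sum_add_distrib] at h
    simpa [dG, dH, Matrix.mul_apply] using h
  have h1 : dH = - (Γ * (G y)⁻¹) - (G y)⁻¹ * Γ.transpose := by
    have hu := hG.isUnit_det hy
    have := congrArg (· * (G y)⁻¹) h0
    simp only [hdG, add_mul, zero_mul, mul_add, Matrix.mul_assoc, Matrix.mul_nonsing_inv _ hu,
      Matrix.mul_one, ← Matrix.mul_assoc (G y)⁻¹ (G y), Matrix.nonsing_inv_mul _ hu,
      Matrix.one_mul] at this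
    rw [eq_neg_of_add_eq_zero_left this]
    abel
  have := congrFun (congrFun h1 b) c
  simpa [dH, Γ, Matrix.mul_apply] using this

/-- With dG = ΓᵀG + GΓ, both terms of tr(G⁻¹dG) equal tr Γ. -/
lemma pd_det (hy : y ∈ S) (a : Fin n) : pd a (fun z ↦ (G z).det) y =
    2 * (∑ b, christoffel G b a b y) * (G y).det := by
  let Γ : Matrix (Fin n) (Fin n) ℝ := Matrix.of fun i j ↦ christoffel G i a j y
  have hdG : (Matrix.of fun i j ↦ pd a (fun z ↦ G z i j) y) = Γ.transpose * G y + G y * Γ := by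
    ext i j
    simp [Γ, Matrix.mul_apply, hG.pd_metric hy]
  have hu := hG.isUnit_det hy
  rw [ConformalQ.pd_det (hG.differentiableAt hy) hu.ne_zero, hdG, mul_add, Matrix.trace_add,
    Matrix.trace_mul_comm, Matrix.mul_assoc, Matrix.mul_nonsing_inv _ hu,
    ← Matrix.mul_assoc, Matrix.nonsing_inv_mul _ hu, Matrix.one_mul, Matrix.mul_one,
    Matrix.trace_transpose]
  simp only [Matrix.trace, Matrix.diag, Γ, Matrix.of_apply]
  ring

end IsMetricOn

end Matrices

/-! ### The scale and the conformal metric are parallel. -/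

section Densities

variable {n : ℕ} {S : Set (Model n)} {G : Model n → Matrix (Fin n) (Fin n) ℝ} {y : Model n}

namespace IsMetricOn

variable (hG : IsMetricOn G S)
include hG

lemma scale_pos (hy : y ∈ S) : 0 < scale G y := Real.rpow_pos_of_pos (hG.det_pos hy) _

lemma contDiffOn_scale : ContDiffOn ℝ ∞ (scale G) S :=
  (contDiffOn_det hG.contDiffOn).rpow_const_of_ne fun _ hz ↦ (hG.det_pos hz).ne'

lemma differentiableAt_scale (hy : y ∈ S) : DifferentiableAt ℝ (scale G) y :=
  (hG.contDiffOn_scale.contDiffAt (hG.isOpen.mem_nhds hy)).differentiableAt (by simp)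

/-- The scale of a metric is parallel. -/
lemma pd_scale (hy : y ∈ S) (a : Fin n) :
    pd a (scale G) y = -(1 / (n : ℝ)) * (∑ b, christoffel G b a b y) * scale G y := by
  have hd : DifferentiableAt ℝ (fun z ↦ (G z).det) y :=
    ((contDiffOn_det hG.contDiffOn).contDiffAt (hG.isOpen.mem_nhds hy)).differentiableAt (by simp)
  have h := hd.hasFDerivAt.rpow_const (p := -(1 / (2 * (n : ℝ)))) (Or.inl (hG.det_pos hy).ne')
  have h' : fderiv ℝ (scale G) y = _ := h.fderiv
  have hdet := hG.pd_det hy a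
  rw [pd] at hdet
  rw [pd, h', smul_apply, hdet, smul_eq_mul,
    Real.rpow_sub_one (hG.det_pos hy).ne', scale]
  have := (hG.det_pos hy).ne'
  have hn : (n : ℝ) ≠ 0 := Nat.cast_ne_zero.2 (Fin.pos a).ne'
  field_simp

lemma confInv_apply (hy : y ∈ S) (b c : Fin n) :
    confInv G y b c = (scale G y ^ 2)⁻¹ * (G y)⁻¹ b c := by
  have hs : scale G y ^ 2 ≠ 0 := (pow_pos (hG.scale_pos hy) 2).ne'
  have : confInv G y = (scale G y ^ 2)⁻¹ • (G y)⁻¹ := by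
    refine Matrix.inv_eq_left_inv ?_
    rw [confMetric, Matrix.smul_mul, Matrix.mul_smul, smul_smul, inv_mul_cancel₀ hs, one_smul,
      Matrix.nonsing_inv_mul _ (hG.isUnit_det hy)]
  rw [this, Matrix.smul_apply, smul_eq_mul]

lemma confInv_symm (hy : y ∈ S) (b c : Fin n) : confInv G y b c = confInv G y c b := by
  rw [hG.confInv_apply hy, hG.confInv_apply hy, hG.inv_symm hy]

lemma contDiffOn_confInv (b c : Fin n) : ContDiffOn ℝ ∞ (fun z ↦ confInv G z b c) S :=
  (((hG.contDiffOn_scale.pow 2).inv fun _ hz ↦ (pow_pos (hG.scale_pos hz) 2).ne').mul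
    (hG.contDiffOn_inv b c)).congr fun _ hz ↦ hG.confInv_apply hz b c

lemma differentiableAt_confInv (hy : y ∈ S) (b c : Fin n) :
    DifferentiableAt ℝ (fun z ↦ confInv G z b c) y :=
  ((hG.contDiffOn_confInv b c).contDiffAt (hG.isOpen.mem_nhds hy)).differentiableAt (by simp)

/-- The inverse conformal metric is parallel. -/
lemma pd_confInv (hy : y ∈ S) (a b c : Fin n) : pd a (fun z ↦ confInv G z b c) y =
    2 / n * (∑ d, christoffel G d a d y) * confInv G y b c
      - ∑ e, christoffel G b a e y * confInv G y e c
      - ∑ e, confInv G y b e * christoffel G c a e y := by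
  have hs : scale G y ≠ 0 := (hG.scale_pos hy).ne'
  -- Differentiating σ² times the inverse conformal metric, which is G⁻¹, gives an equation whose
  -- terms all carry the factor σ², cancelled at the end.
  have h1 : pd a (fun z ↦ scale G z ^ 2 * confInv G z b c) y = pd a (fun z ↦ (G z)⁻¹ b c) y :=
    pd_congr_on hG.isOpen (fun z hz ↦ by
      rw [hG.confInv_apply hz, mul_inv_cancel_left₀ (pow_pos (hG.scale_pos hz) 2).ne']) hy a
  have hsd := hG.differentiableAt_scale hy
  have hH (i j : Fin n) : (G y)⁻¹ i j = scale G y ^ 2 * confInv G y i j := by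
    rw [hG.confInv_apply hy, mul_inv_cancel_left₀ (pow_pos (hG.scale_pos hy) 2).ne']
  simp only [pow_two] at h1
  rw [pd_mul (hsd.fun_mul hsd) (hG.differentiableAt_confInv hy b c), pd_mul hsd hsd,
    hG.pd_scale hy, hG.pd_inv hy] at h1
  simp only [hH, mul_left_comm _ (scale G y ^ 2) _, mul_assoc (scale G y ^ 2),
    ← Finset.mul_sum] at h1
  refine mul_left_cancel₀ (pow_ne_zero 2 hs) ?_
  linear_combination h1

end IsMetricOn

end Densities

/-! ### Conformal change of the metric and of the connection. -/

section Conformal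

variable {n : ℕ} {S : Set (Model n)} {G : Model n → Matrix (Fin n) (Fin n) ℝ} {y : Model n}
  {u : Model n → ℝ}

/-- The components of the metric `e^{2u} g`. -/
def rescale (u : Model n → ℝ) (G : Model n → Matrix (Fin n) (Fin n) ℝ) (z : Model n) :
    Matrix (Fin n) (Fin n) ℝ :=
  Real.exp (2 * u z) • G z

lemma rescale_apply (i j : Fin n) : rescale u G y i j = Real.exp (2 * u y) * G y i j := rfl

lemma rescale_inv_apply (i j : Fin n) :
    (rescale u G y)⁻¹ i j = (Real.exp (2 * u y))⁻¹ * (G y)⁻¹ i j := by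
  have : (rescale u G y)⁻¹ = (Real.exp (2 * u y))⁻¹ • (G y)⁻¹ := by
    by_cases h : IsUnit (G y).det
    · refine Matrix.inv_eq_left_inv ?_
      rw [rescale, Matrix.smul_mul, Matrix.mul_smul, smul_smul,
        inv_mul_cancel₀ (Real.exp_ne_zero _), one_smul, Matrix.nonsing_inv_mul _ h]
    -- For a singular matrix both inverses are zero by convention, so no metric hypothesis is
    -- needed.
    · rw [Matrix.nonsing_inv_apply_not_isUnit _ h, Matrix.nonsing_inv_apply_not_isUnit, smul_zero]
      simpa [rescale, Matrix.det_smul, Real.exp_ne_zero] using h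
  rw [this, Matrix.smul_apply, smul_eq_mul]

namespace IsMetricOn

variable (hG : IsMetricOn G S) (hu : ContDiffOn ℝ ∞ u S)
include hG

lemma scale_rescale [NeZero n] (hy : y ∈ S) :
    scale (rescale u G) y = Real.exp (-u y) * scale G y := by
  have hn : (n : ℝ) ≠ 0 := NeZero.ne _
  rw [scale, rescale, Matrix.det_smul, Fintype.card_fin,
    Real.mul_rpow (by positivity) (hG.det_pos hy).le, ← Real.exp_nat_mul, ← Real.exp_mul, scale]
  congr 2
  field_simp

/-- The inverse conformal metric depends only on the conformal class. -/
lemma confInv_rescale [NeZero n] (hy : y ∈ S) : confInv (rescale u G) y = confInv G y := by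
  rw [confInv, confInv, confMetric, confMetric, hG.scale_rescale hy, rescale, smul_smul, mul_pow,
    mul_right_comm, ← Real.exp_nat_mul, ← Real.exp_add]
  simp

include hu

lemma rescale : IsMetricOn (rescale u G) S where
  isOpen := hG.isOpen
  contDiffOn i j := ((contDiffOn_const.mul hu).exp).mul (hG.contDiffOn i j)
  posDef z hz := (hG.posDef z hz).smul (Real.exp_pos _)

lemma differentiableAt_of_contDiffOn (hy : y ∈ S) : DifferentiableAt ℝ u y :=
  (hu.contDiffAt (hG.isOpen.mem_nhds hy)).differentiableAt (by simp)

lemma pd_rescale (hy : y ∈ S) (a i j : Fin n) :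
    pd a (fun z ↦ ConformalQ.rescale u G z i j) y =
      Real.exp (2 * u y) * (pd a (fun z ↦ G z i j) y + 2 * pd a u y * G y i j) := by
  have hd : DifferentiableAt ℝ (fun z ↦ 2 * u z) y :=
    (hG.differentiableAt_of_contDiffOn hu hy).const_mul 2
  have he : pd a (fun z ↦ Real.exp (2 * u z)) y = Real.exp (2 * u y) * (2 * pd a u y) := by
    rw [← pd_const_mul (hG.differentiableAt_of_contDiffOn hu hy), pd, fderiv_exp hd]
    rfl
  simp only [rescale_apply]
  rw [pd_mul hd.exp (hG.differentiableAt hy i j), he]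
  ring

/-- The exponential factors of metric and inverse cancel, and the derivative of the factor
contributes 2Υ_a g_ij to each ∂_a g_ij. -/
lemma christoffel_rescale (hy : y ∈ S) (c a b : Fin n) :
    christoffel (ConformalQ.rescale u G) c a b y = christoffel G c a b y
      + ((if c = b then pd a u y else 0) + (if c = a then pd b u y else 0)
        - (∑ d, (G y)⁻¹ c d * pd d u y) * G y a b) := by
  -- Writing each Kronecker delta as G⁻¹G makes both sides sums over d, to be compared term by term.
  have h (e f : Fin n) : (if c = f then pd e u y else 0) =
      ∑ d, (G y)⁻¹ c d * G y f d * pd e u y := by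
    rw [← Finset.sum_mul]
    simp only [hG.symm hy f, hG.sum_inv_mul hy, ite_mul, one_mul, zero_mul]
  rw [h, h, Finset.sum_mul, ← Finset.sum_add_distrib, ← Finset.sum_sub_distrib]
  simp only [christoffel, Finset.mul_sum]
  rw [← Finset.sum_add_distrib]
  refine Finset.sum_congr rfl fun d _ ↦ ?_
  rw [rescale_inv_apply, hG.pd_rescale hu hy, hG.pd_rescale hu hy, hG.pd_rescale hu hy]
  have := Real.exp_ne_zero (2 * u y)
  field_simp
  ring

end IsMetricOn

end Conformal

/-! ### Conformal change of the Ricci tensor. -/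

section Ricci

variable {n : ℕ}

/-- The quadratic terms of the Ricci tensor, for a connection `Γ` changed by the difference tensor
`δ^c_b υ_a + δ^c_a υ_b - U^c g_{ab}` of a conformal change. -/
lemma sum_quadratic_conformal (Γ Γ' : Fin n → Fin n → Fin n → ℝ)
    (g : Fin n → Fin n → ℝ) (υ U : Fin n → ℝ) (hgs : ∀ i j, g i j = g j i)
    (hΓ : ∀ c a b, Γ c a b = Γ c b a)
    (hU : ∀ b, ∑ a, U a * g a b = υ b)
    (h : ∀ c a b, Γ' c a b = Γ c a b +
      ((if c = b then υ a else 0) + (if c = a then υ b else 0) - U c * g a b)) (b c : Fin n) :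
    ∑ a, ∑ e, (Γ' a a e * Γ' e b c - Γ' a b e * Γ' e a c) =
      ∑ a, ∑ e, (Γ a a e * Γ e b c - Γ a b e * Γ e a c)
      + (n - 2) * ∑ e, Γ e b c * υ e - (∑ a, ∑ e, Γ a a e * U e) * g b c
      + ∑ a, ∑ e, U a * (Γ e a b * g e c + g b e * Γ e a c)
      + (n - 2) * υ b * υ c - (n - 2) * (∑ e, U e * υ e) * g b c := by
  -- With Γ' = Γ + D, each of the two products yields ΓD, DΓ and DD contractions; `h1` to `h6`
  -- evaluate these six.
  obtain ⟨D, hD, hΓ'⟩ : ∃ D : Fin n → Fin n → Fin n → ℝ, (∀ c a b, D c a b =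
      (if c = b then υ a else 0) + (if c = a then υ b else 0) - U c * g a b) ∧
      ∀ c a b, Γ' c a b = Γ c a b + D c a b := ⟨_, fun _ _ _ ↦ rfl, h⟩
  have hU' (b : Fin n) : ∑ a, U a * g b a = υ b := by simp_rw [hgs b, hU]
  have h1 : ∑ a, ∑ e, Γ a a e * D e b c = (∑ a, Γ a a c) * υ b + (∑ a, Γ a a b) * υ c
      - (∑ a, ∑ e, Γ a a e * U e) * g b c := by
    simp only [hD, mul_sub, mul_add, Finset.sum_add_distrib, Finset.sum_sub_distrib,
      mul_ite, mul_zero, Finset.sum_ite_eq', Finset.mem_univ, if_true, Finset.sum_mul, mul_assoc]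
  have htr (e : Fin n) : ∑ a, D a a e = n * υ e := by
    simp [hD, Finset.sum_add_distrib, hU]
  have h2 : ∑ a, ∑ e, D a a e * Γ e b c = n * ∑ e, Γ e b c * υ e := by
    rw [Finset.sum_comm, Finset.mul_sum]
    simp only [← Finset.sum_mul, htr]
    exact Finset.sum_congr rfl fun e _ ↦ by ring
  have h3 : ∑ a, ∑ e, D a a e * D e b c = n * (2 * υ b * υ c - (∑ e, U e * υ e) * g b c) := by
    rw [Finset.sum_comm]
    simp only [← Finset.sum_mul, htr]
    simp only [hD, mul_sub, mul_add, Finset.sum_add_distrib, Finset.sum_sub_distrib,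
      mul_ite, mul_zero, Finset.sum_ite_eq', Finset.mem_univ, if_true, Finset.sum_mul,
      Finset.mul_sum]
    rw [Finset.sum_congr rfl fun e _ ↦ show (n : ℝ) * υ e * (U e * g b c) =
      n * (U e * υ e * g b c) by ring]
    ring
  have h4 : ∑ a, ∑ e, Γ a b e * D e a c = (∑ a, Γ a a b) * υ c + ∑ e, Γ e b c * υ e
      - ∑ a, ∑ e, U a * (Γ e a b * g e c) := by
    simp only [hD, mul_sub, mul_add, Finset.sum_add_distrib, Finset.sum_sub_distrib,
      mul_ite, mul_zero, Finset.sum_ite_eq', Finset.mem_univ, if_true, Finset.sum_mul]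
    rw [Finset.sum_comm (f := fun a e ↦ U a * _)]
    simp only [hΓ _ b]
    rw [add_comm (∑ x, Γ x c b * υ x)]
    congr 1
    exact Finset.sum_congr rfl fun a _ ↦ Finset.sum_congr rfl fun e _ ↦ by ring
  -- Kept general in X, since it serves both X = Γ (`h5`) and X = D (`h6`).
  have hX (X : Fin n → Fin n → ℝ) : ∑ a, ∑ e, D a b e * X e a =
      ∑ e, X e b * υ e + (∑ a, X a a) * υ b - ∑ a, ∑ e, U a * (g b e * X e a) := by
    simp only [hD, sub_mul, add_mul, Finset.sum_add_distrib, Finset.sum_sub_distrib,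
      ite_mul, zero_mul, Finset.sum_ite_eq, Finset.mem_univ, if_true, Finset.sum_mul, mul_assoc,
      mul_comm (υ _)]
    rw [add_comm (∑ i, X i i * υ b)]
    congr 2
    rw [Finset.sum_comm]
    simp
  have h5 : ∑ a, ∑ e, D a b e * Γ e a c = ∑ e, Γ e b c * υ e + (∑ a, Γ a a c) * υ b
      - ∑ a, ∑ e, U a * (g b e * Γ e a c) := hX fun e a ↦ Γ e a c
  have h6 : ∑ a, ∑ e, D a b e * D e a c = (n + 2) * υ b * υ c
      - 2 * (∑ e, U e * υ e) * g b c := by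
    have e1 : ∑ e, D e b c * υ e = 2 * υ b * υ c - (∑ e, U e * υ e) * g b c := by
      simp only [hD, sub_mul, add_mul, Finset.sum_add_distrib, Finset.sum_sub_distrib,
        ite_mul, zero_mul, Finset.sum_ite_eq', Finset.mem_univ, if_true, Finset.sum_mul,
        mul_right_comm _ (g b c)]
      ring
    have e2 (a : Fin n) : ∑ e, U a * (g b e * D e a c) =
        U a * υ a * g b c + U a * g b a * υ c - U a * g a c * υ b := by
      rw [← Finset.mul_sum]
      simp only [hD, mul_sub, mul_add, Finset.sum_add_distrib, Finset.sum_sub_distrib,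
        mul_ite, mul_zero, Finset.sum_ite_eq', Finset.mem_univ, if_true, ← mul_assoc,
        mul_comm (g b _) (U _), ← Finset.sum_mul, hU']
      ring
    rw [hX fun e a ↦ D e a c, e1, htr]
    simp only [e2, Finset.sum_add_distrib, Finset.sum_sub_distrib, ← Finset.sum_mul, hU, hU']
    ring
  have h7 (a e : Fin n) : (Γ a a e + D a a e) * (Γ e b c + D e b c)
        - (Γ a b e + D a b e) * (Γ e a c + D e a c) = (Γ a a e * Γ e b c - Γ a b e * Γ e a c)
      + Γ a a e * D e b c + D a a e * Γ e b c + D a a e * D e b c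
      - Γ a b e * D e a c - D a b e * Γ e a c - D a b e * D e a c := by ring
  simp only [hΓ', h7, mul_add (U _)]
  simp only [Finset.sum_add_distrib, Finset.sum_sub_distrib] at h1 h2 h3 h4 h5 h6 ⊢
  rw [h1, h2, h3, h4, h5, h6]
  ring

variable {S : Set (Model n)} {G : Model n → Matrix (Fin n) (Fin n) ℝ} {y : Model n}
  {u : Model n → ℝ}

namespace IsMetricOn

variable (hG : IsMetricOn G S) (hu : ContDiffOn ℝ ∞ u S)
include hG

lemma sum_grad_mul (hy : y ∈ S) (b : Fin n) :
    ∑ a, (∑ d, (G y)⁻¹ a d * pd d u y) * G y a b = pd b u y := by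
  simp only [Finset.sum_mul]
  rw [Finset.sum_comm]
  simp only [mul_right_comm, ← Finset.sum_mul, hG.inv_symm hy _, hG.sum_inv_mul hy, ite_mul,
    one_mul, zero_mul]
  simp

include hu

lemma differentiableAt_pd (hy : y ∈ S) (a : Fin n) : DifferentiableAt ℝ (pd a u) y :=
  hG.differentiableAt_of_contDiffOn (contDiffOn_pd hG.isOpen hu a) hy

lemma differentiableAt_grad (hy : y ∈ S) (c : Fin n) :
    DifferentiableAt ℝ (fun z ↦ ∑ d, (G z)⁻¹ c d * pd d u z) y :=
  DifferentiableAt.fun_sum fun d _ ↦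
    (hG.differentiableAt_inv hy c d).fun_mul (hG.differentiableAt_pd hu hy d)

/-- The covariant derivative of the gradient vector field is the Hessian. -/
lemma pd_grad (hy : y ∈ S) (e c : Fin n) :
    pd e (fun z ↦ ∑ d, (G z)⁻¹ c d * pd d u z) y =
      ∑ d, (G y)⁻¹ c d * covForm G (fun b ↦ pd b u) e d y
        - ∑ k, christoffel G c e k y * ∑ d, (G y)⁻¹ k d * pd d u y := by
  rw [pd_sum _ fun d _ ↦
    (hG.differentiableAt_inv hy c d).fun_mul (hG.differentiableAt_pd hu hy d)]
  simp only [pd_mul (hG.differentiableAt_inv hy c _) (hG.differentiableAt_pd hu hy _),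
    hG.pd_inv hy, covForm, mul_sub, sub_mul, neg_mul, Finset.sum_add_distrib,
    Finset.sum_sub_distrib, Finset.sum_neg_distrib, Finset.sum_mul, Finset.mul_sum, mul_assoc]
  rw [Finset.sum_comm, Finset.sum_comm (f := fun x i ↦ (G y)⁻¹ c i * _)]
  ring

lemma covForm_pd_symm (hy : y ∈ S) (a b : Fin n) :
    covForm G (fun b ↦ pd b u) a b y = covForm G (fun b ↦ pd b u) b a y := by
  simp only [covForm, pd_comm hG.isOpen hu hy a b, hG.christoffel_symm hy _ a b]

/-- The second derivatives of u enter as (2 - n)∂_b∂_c u and join the (n - 2)Γ^e_{bc}Υ_e of the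
quadratic part to form the Hessian. The other noncovariant terms cancel: U^a∂_a g_bc by metric
compatibility (`t4`), and Γ^a_{ak}U^k against the divergence of the gradient U (`t5`). -/
lemma ricci_rescale (hy : y ∈ S) (b c : Fin n) :
    ricci (ConformalQ.rescale u G) b c y = ricci G b c y
      - (n - 2) * covForm G (fun b ↦ pd b u) b c y
      - (∑ a, ∑ d, (G y)⁻¹ a d * covForm G (fun b ↦ pd b u) a d y) * G y b c
      + (n - 2) * pd b u y * pd c u y
      - (n - 2) * (∑ a, ∑ d, (G y)⁻¹ a d * (pd a u y * pd d u y)) * G y b c := by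
  have hG' := hG.rescale hu
  have hdΓ (c a b : Fin n) : DifferentiableAt ℝ (christoffel G c a b) y :=
    hG.differentiableAt_of_contDiffOn (hG.contDiffOn_christoffel c a b) hy
  have hdΓ' (c a b : Fin n) : DifferentiableAt ℝ (christoffel (ConformalQ.rescale u G) c a b) y :=
    hG.differentiableAt_of_contDiffOn (hG'.contDiffOn_christoffel c a b) hy
  have hdu := hG.differentiableAt_pd hu hy
  have hdU := hG.differentiableAt_grad hu hy
  have t1 : ∑ a, pd a (christoffel (ConformalQ.rescale u G) a b c) y =
      ∑ a, pd a (christoffel G a b c) y + 2 * pd b (pd c u) y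
        - (∑ a, pd a (fun z ↦ ∑ d, (G z)⁻¹ a d * pd d u z) y) * G y b c
        - ∑ a, (∑ d, (G y)⁻¹ a d * pd d u y) * pd a (fun z ↦ G z b c) y := by
    have h (a : Fin n) : pd a (christoffel (ConformalQ.rescale u G) a b c) y =
        pd a (christoffel G a b c) y + (if a = c then pd a (pd b u) y else 0)
          + (if a = b then pd a (pd c u) y else 0)
          - pd a (fun z ↦ ∑ d, (G z)⁻¹ a d * pd d u z) y * G y b c
          - (∑ d, (G y)⁻¹ a d * pd d u y) * pd a (fun z ↦ G z b c) y := by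
      rw [pd_congr_on hG.isOpen (fun z hz ↦ hG.christoffel_rescale hu hz a b c) hy]
      have hi (p q r : Fin n) : DifferentiableAt ℝ (fun z ↦ if p = q then pd r u z else 0) y := by
        split_ifs
        exacts [hdu r, differentiableAt_const _]
      have hj (p q r s : Fin n) : pd s (fun z ↦ if p = q then pd r u z else 0) y =
          if p = q then pd s (pd r u) y else 0 := by
        split_ifs
        exacts [rfl, pd_const _ _]
      rw [pd_add (hdΓ a b c) (((hi a c b).fun_add (hi a b c)).fun_sub
          ((hdU a).fun_mul (hG.differentiableAt hy b c))),
        pd_sub ((hi a c b).fun_add (hi a b c)) ((hdU a).fun_mul (hG.differentiableAt hy b c)),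
        pd_add (hi a c b) (hi a b c), pd_mul (hdU a) (hG.differentiableAt hy b c), hj, hj]
      ring
    simp only [h, Finset.sum_add_distrib, Finset.sum_sub_distrib, Finset.sum_ite_eq',
      Finset.mem_univ, if_true, Finset.sum_mul]
    rw [pd_comm hG.isOpen hu hy c b]
    ring
  have t2 : ∑ a, pd b (christoffel (ConformalQ.rescale u G) a a c) y =
      ∑ a, pd b (christoffel G a a c) y + n * pd b (pd c u) y := by
    rw [← pd_sum _ fun a _ ↦ hdΓ' a a c, ← pd_sum _ fun a _ ↦ hdΓ a a c, ← pd_const_mul (hdu c),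
      ← pd_add (DifferentiableAt.fun_sum fun a _ ↦ hdΓ a a c) ((hdu c).const_mul _)]
    refine pd_congr_on hG.isOpen (fun z hz ↦ ?_) hy b
    simp only [hG.christoffel_rescale hu hz, Finset.sum_add_distrib, Finset.sum_sub_distrib,
      hG.sum_grad_mul hz]
    simp
  have t3 := sum_quadratic_conformal (fun c a b ↦ christoffel G c a b y)
    (fun c a b ↦ christoffel (ConformalQ.rescale u G) c a b y) (fun a b ↦ G y a b)
    (fun a ↦ pd a u y) (fun c ↦ ∑ d, (G y)⁻¹ c d * pd d u y) (hG.symm hy)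
    (hG.christoffel_symm hy) (hG.sum_grad_mul hy)
    (hG.christoffel_rescale hu hy) b c
  have t4 : ∑ a, (∑ d, (G y)⁻¹ a d * pd d u y) * pd a (fun z ↦ G z b c) y =
      ∑ a, ∑ e, (∑ d, (G y)⁻¹ a d * pd d u y) * (christoffel G e a b y * G y e c +
        G y b e * christoffel G e a c y) := by
    simp only [hG.pd_metric hy, ← Finset.sum_add_distrib, Finset.mul_sum]
  have t5 : ∑ a, pd a (fun z ↦ ∑ d, (G z)⁻¹ a d * pd d u z) y =
      ∑ a, ∑ d, (G y)⁻¹ a d * covForm G (fun b ↦ pd b u) a d y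
        - ∑ a, ∑ k, christoffel G a a k y * ∑ d, (G y)⁻¹ k d * pd d u y := by
    simp only [hG.pd_grad hu hy, Finset.sum_sub_distrib]
  have t6 : ∑ e, (∑ d, (G y)⁻¹ e d * pd d u y) * pd e u y =
      ∑ a, ∑ d, (G y)⁻¹ a d * (pd a u y * pd d u y) := by
    simp only [Finset.sum_mul]
    exact Finset.sum_congr rfl fun a _ ↦ Finset.sum_congr rfl fun d _ ↦ by ring
  have t7 : covForm G (fun b ↦ pd b u) b c y =
      pd b (pd c u) y - ∑ e, christoffel G e b c y * pd e u y := rfl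
  have r (A : Model n → Matrix (Fin n) (Fin n) ℝ) : ricci A b c y =
      ∑ a, pd a (christoffel A a b c) y - ∑ a, pd b (christoffel A a a c) y
        + ∑ a, ∑ e, (christoffel A a a e y * christoffel A e b c y
          - christoffel A a b e y * christoffel A e a c y) := by
    simp only [ricci, riemann, Finset.sum_add_distrib, Finset.sum_sub_distrib]
  rw [r, r, t1, t2, t3, t4, t5, t6, t7]
  ring

end IsMetricOn

end Ricci

/-! ### Conformal change of the scalar curvature, the Schouten tensor and its trace. -/

section Schouten

variable {n : ℕ} {S : Set (Model n)} {G : Model n → Matrix (Fin n) (Fin n) ℝ} {y : Model n}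
  {u : Model n → ℝ}

namespace IsMetricOn

variable (hG : IsMetricOn G S)
include hG

lemma sum_sum_inv_mul (hy : y ∈ S) : ∑ a, ∑ b, (G y)⁻¹ a b * G y a b = n := by
  have h (a : Fin n) : ∑ b, (G y)⁻¹ a b * G y a b = 1 := by
    simp only [hG.symm hy a, hG.sum_inv_mul hy, if_true]
  simp [h]

lemma sum_confInv_mul (hy : y ∈ S) (X : Fin n → Fin n → ℝ) :
    ∑ a, ∑ b, confInv G y a b * X a b = (scale G y ^ 2)⁻¹ * ∑ a, ∑ b, (G y)⁻¹ a b * X a b := by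
  simp only [hG.confInv_apply hy, Finset.mul_sum, mul_assoc]

variable (hu : ContDiffOn ℝ ∞ u S)
include hu

lemma scalarCurvature_rescale (hy : y ∈ S) :
    Real.exp (2 * u y) * scalarCurvature (ConformalQ.rescale u G) y = scalarCurvature G y
      - 2 * (n - 1) * ∑ a, ∑ b, (G y)⁻¹ a b * covForm G (fun b ↦ pd b u) a b y
      - (n - 1) * (n - 2) * ∑ a, ∑ b, (G y)⁻¹ a b * (pd a u y * pd b u y) := by
  set Δ := ∑ a, ∑ b, (G y)⁻¹ a b * covForm G (fun b ↦ pd b u) a b y with hΔ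
  set N := ∑ a, ∑ b, (G y)⁻¹ a b * (pd a u y * pd b u y) with hN
  have h (a b : Fin n) : Real.exp (2 * u y) *
      ((ConformalQ.rescale u G y)⁻¹ a b * ricci (ConformalQ.rescale u G) a b y) =
      (G y)⁻¹ a b * ricci G a b y
        - (n - 2) * ((G y)⁻¹ a b * covForm G (fun b ↦ pd b u) a b y)
        + (n - 2) * ((G y)⁻¹ a b * (pd a u y * pd b u y))
        - (Δ + (n - 2) * N) * ((G y)⁻¹ a b * G y a b) := by
    rw [rescale_inv_apply, hG.ricci_rescale hu hy, ← hΔ, ← hN]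
    have := Real.exp_ne_zero (2 * u y)
    field_simp
    ring
  simp only [scalarCurvature, Finset.mul_sum, h]
  simp only [Finset.sum_add_distrib, Finset.sum_sub_distrib, ← Finset.mul_sum,
    hG.sum_sum_inv_mul hy, ← hΔ, ← hN]
  ring

/-- The Laplacian terms of the Ricci tensor and the scalar curvature cancel, which is what the
normalisation of P achieves; division by n - 2 and n - 1 needs n > 2. -/
lemma schouten_rescale (hn : 2 < n) (hy : y ∈ S) (a b : Fin n) :
    schouten (ConformalQ.rescale u G) a b y = schouten G a b y
      - covForm G (fun b ↦ pd b u) a b y + pd a u y * pd b u y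
      - 1 / 2 * (∑ a, ∑ b, (G y)⁻¹ a b * (pd a u y * pd b u y)) * G y a b := by
  have h2 : (n : ℝ) - 2 ≠ 0 := sub_ne_zero.2 (by exact_mod_cast hn.ne')
  have h1 : (n : ℝ) - 1 ≠ 0 := sub_ne_zero.2 (by exact_mod_cast (by omega : n ≠ 1))
  have hR := hG.scalarCurvature_rescale hu hy
  have hR' : scalarCurvature (ConformalQ.rescale u G) y / (2 * ((n : ℝ) - 1)) *
      (Real.exp (2 * u y) * G y a b) = (Real.exp (2 * u y) *
        scalarCurvature (ConformalQ.rescale u G) y) / (2 * ((n : ℝ) - 1)) * G y a b := by ring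
  rw [schouten, schouten, rescale_apply, hR', hR, hG.ricci_rescale hu hy]
  field_simp
  ring

/-- The coefficient n/2 - 1 combines the traces of Υ_aΥ_b and of -½|Υ|²g_ab. -/
lemma schoutenTrace_rescale (hn : 2 < n) (hy : y ∈ S) :
    schoutenTrace (ConformalQ.rescale u G) y = schoutenTrace G y
      - ∑ a, ∑ b, confInv G y a b * covForm G (fun b ↦ pd b u) a b y
      - (n / 2 - 1) * ∑ a, ∑ b, confInv G y a b * (pd a u y * pd b u y) := by
  have : NeZero n := ⟨by omega⟩
  have h (X : ℝ) : ∑ a, ∑ b, confInv G y a b * (X * G y a b) =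
      X * ((scale G y ^ 2)⁻¹ * n) := by
    rw [← hG.sum_sum_inv_mul hy, ← hG.sum_confInv_mul hy fun a b ↦ G y a b]
    simp only [mul_left_comm _ X, Finset.mul_sum]
  simp only [schoutenTrace, hG.confInv_rescale hy, hG.schouten_rescale hu hn hy, mul_sub, mul_add,
    Finset.sum_add_distrib, Finset.sum_sub_distrib, h]
  rw [hG.sum_confInv_mul hy fun a b ↦ pd a u y * pd b u y]
  ring

/-- The action of P on a covector, with the Hessian contracted in the index order that
`divTwoTensor_skewCovForm` produces. -/
lemma sum_schouten_rescale (hn : 2 < n) (hy : y ∈ S) (w : Fin n → ℝ) (a : Fin n) :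
    ∑ b, (∑ c, schouten (ConformalQ.rescale u G) a c y * confInv G y c b) * w b =
      ∑ b, (∑ c, schouten G a c y * confInv G y c b) * w b
      - ∑ b, ∑ c, confInv G y b c * (covForm G (fun b ↦ pd b u) c a y * w b)
      + pd a u y * ∑ b, ∑ c, confInv G y b c * (pd b u y * w c)
      - 1 / 2 * (∑ b, ∑ c, confInv G y b c * (pd b u y * pd c u y)) * w a := by
  set N := ∑ a, ∑ b, (G y)⁻¹ a b * (pd a u y * pd b u y) with hN
  have hd (b : Fin n) : ∑ c, G y a c * confInv G y c b =
      (scale G y ^ 2)⁻¹ * if a = b then 1 else 0 := by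
    simp only [hG.confInv_apply hy, mul_left_comm _ (scale G y ^ 2)⁻¹, ← Finset.mul_sum,
      hG.sum_mul_inv hy]
  have h1 (b : Fin n) : ∑ c, schouten (ConformalQ.rescale u G) a c y * confInv G y c b =
      ∑ c, schouten G a c y * confInv G y c b
        - ∑ c, confInv G y b c * covForm G (fun b ↦ pd b u) c a y
        + pd a u y * ∑ c, confInv G y c b * pd c u y
        - 1 / 2 * N * ((scale G y ^ 2)⁻¹ * if a = b then 1 else 0) := by
    rw [← hd, Finset.mul_sum, Finset.mul_sum, ← Finset.sum_sub_distrib, ← Finset.sum_add_distrib,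
      ← Finset.sum_sub_distrib]
    refine Finset.sum_congr rfl fun c _ ↦ ?_
    rw [hG.schouten_rescale hu hn hy, hG.confInv_symm hy b c, hG.covForm_pd_symm hu hy a c, ← hN]
    ring
  simp only [h1, sub_mul, add_mul, Finset.sum_sub_distrib, Finset.sum_add_distrib]
  rw [hG.sum_confInv_mul hy fun b c ↦ pd b u y * pd c u y, ← hN,
    Finset.sum_comm (f := fun b c ↦ confInv G y b c * (pd b u y * w c))]
  simp only [Finset.sum_mul, Finset.mul_sum, mul_assoc, mul_ite, mul_one, mul_zero, ite_mul,
    zero_mul, Finset.sum_ite_eq, Finset.mem_univ, if_true]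
  ring

end IsMetricOn

end Schouten

/-! ### Differential operators on 1-forms and densities, and the variation of Q₁. -/

section Forms

variable {n : ℕ} {S : Set (Model n)} {G : Model n → Matrix (Fin n) (Fin n) ℝ} {y : Model n}
  {u : Model n → ℝ} {α β : Fin n → Model n → ℝ}

lemma covDensity_add {f h : Model n → ℝ} (hf : DifferentiableAt ℝ f y)
    (hh : DifferentiableAt ℝ h y) (w : ℝ) (a : Fin n) :
    covDensity G w (fun z ↦ f z + h z) a y = covDensity G w f a y + covDensity G w h a y := by
  rw [covDensity, covDensity, covDensity, pd_add hf hh]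
  ring

lemma covDensity_const_mul {f : Model n → ℝ} (hf : DifferentiableAt ℝ f y) (w k : ℝ) (a : Fin n) :
    covDensity G w (fun z ↦ k * f z) a y = k * covDensity G w f a y := by
  rw [covDensity, covDensity, pd_const_mul hf]
  ring

lemma covDensity_congr {f h : Model n → ℝ} (hS : IsOpen S) (hfh : ∀ z ∈ S, f z = h z)
    (hy : y ∈ S) (w : ℝ) (a : Fin n) : covDensity G w f a y = covDensity G w h a y := by
  rw [covDensity, covDensity, pd_congr_on hS hfh hy, hfh y hy]

lemma covTwoTensor_congr {T T' : Fin n → Fin n → Model n → ℝ} (hS : IsOpen S)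
    (hT : ∀ a b, ∀ z ∈ S, T a b z = T' a b z) (hy : y ∈ S) (c a b : Fin n) :
    covTwoTensor G T c a b y = covTwoTensor G T' c a b y := by
  simp only [covTwoTensor, pd_congr_on hS (hT a b) hy, hT _ _ y hy]

/-- The Leibniz rule for the skew product of two 1-forms. -/
lemma covTwoTensor_skew (hα : ∀ b, DifferentiableAt ℝ (α b) y)
    (hβ : ∀ b, DifferentiableAt ℝ (β b) y) (c a b : Fin n) :
    covTwoTensor G (fun a b z ↦ 1 / 2 * (α a z * β b z - α b z * β a z)) c a b y =
      1 / 2 * (covForm G α c a y * β b y + α a y * covForm G β c b y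
        - covForm G α c b y * β a y - α b y * covForm G β c a y) := by
  have h (a b : Fin n) := (hα a).fun_mul (hβ b)
  have e1 : ∑ d, christoffel G d c a y * (1 / 2 * (α d y * β b y - α b y * β d y)) =
      1 / 2 * ((∑ d, christoffel G d c a y * α d y) * β b y
        - α b y * ∑ d, christoffel G d c a y * β d y) := by
    rw [Finset.sum_mul, Finset.mul_sum, ← Finset.sum_sub_distrib, Finset.mul_sum]
    exact Finset.sum_congr rfl fun d _ ↦ by ring
  have e2 : ∑ d, christoffel G d c b y * (1 / 2 * (α a y * β d y - α d y * β a y)) =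
      1 / 2 * (α a y * (∑ d, christoffel G d c b y * β d y)
        - (∑ d, christoffel G d c b y * α d y) * β a y) := by
    rw [Finset.sum_mul, Finset.mul_sum, ← Finset.sum_sub_distrib, Finset.mul_sum]
    exact Finset.sum_congr rfl fun d _ ↦ by ring
  rw [covTwoTensor, e1, e2, pd_const_mul ((h a b).fun_sub (h b a)), pd_sub (h a b) (h b a),
    pd_mul (hα a) (hβ b), pd_mul (hα b) (hβ a)]
  simp only [covForm]
  ring

namespace IsMetricOn

variable (hG : IsMetricOn G S)
include hG

/-- The Leibniz rule for the conformal inner product of two 1-forms. -/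
lemma covDensity_inner (hα : ∀ b, DifferentiableAt ℝ (α b) y)
    (hβ : ∀ b, DifferentiableAt ℝ (β b) y) (hy : y ∈ S) (a : Fin n) :
    covDensity G (-2) (fun z ↦ ∑ b, ∑ c, confInv G z b c * (α b z * β c z)) a y =
      ∑ b, ∑ c, confInv G y b c * (covForm G α a b y * β c y)
      + ∑ b, ∑ c, confInv G y b c * (α b y * covForm G β a c y) := by
  have hK := hG.differentiableAt_confInv hy
  have hd (b c : Fin n) : DifferentiableAt ℝ (fun z ↦ confInv G z b c * (α b z * β c z)) y :=
    (hK b c).fun_mul ((hα b).fun_mul (hβ c))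
  rw [covDensity, pd_sum _ fun b _ ↦ DifferentiableAt.fun_sum fun c _ ↦ hd b c]
  simp only [pd_sum _ fun c _ ↦ hd _ c, pd_mul (hK _ _) ((hα _).fun_mul (hβ _)),
    pd_mul (hα _) (hβ _), hG.pd_confInv hy]
  have e1 : ∑ b, ∑ c, (∑ e, christoffel G b a e y * confInv G y e c) * (α b y * β c y) =
      ∑ b, ∑ c, confInv G y b c * ((∑ e, christoffel G e a b y * α e y) * β c y) := by
    simp only [Finset.sum_mul, Finset.mul_sum]
    rw [Finset.sum_congr rfl fun b _ ↦ Finset.sum_comm, Finset.sum_comm]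
    refine Finset.sum_congr rfl fun b _ ↦ ?_
    rw [Finset.sum_comm]
    exact Finset.sum_congr rfl fun c _ ↦ Finset.sum_congr rfl fun e _ ↦ by ring
  have e2 : ∑ b, ∑ c, (∑ e, confInv G y b e * christoffel G c a e y) * (α b y * β c y) =
      ∑ b, ∑ c, confInv G y b c * (α b y * ∑ e, christoffel G e a c y * β e y) := by
    simp only [Finset.sum_mul, Finset.mul_sum]
    refine Finset.sum_congr rfl fun b _ ↦ ?_
    rw [Finset.sum_comm]
    exact Finset.sum_congr rfl fun c _ ↦ Finset.sum_congr rfl fun e _ ↦ by ring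
  simp only [covForm, mul_sub, sub_mul, mul_add, Finset.sum_add_distrib, Finset.sum_sub_distrib,
    e1, e2]
  simp only [mul_assoc, ← Finset.mul_sum]
  ring

/-- The connection is torsion-free, so the skew part is half of d(uα), and closedness reduces d(uα)
to du ∧ α. -/
lemma skewCovForm_mul (hα : ∀ b, DifferentiableAt ℝ (α b) y) (hu : ContDiffOn ℝ ∞ u S)
    (hy : y ∈ S) (hc : ∀ a b, pd a (α b) y = pd b (α a) y) (a b : Fin n) :
    skewCovForm G (fun b z ↦ u z * α b z) a b y =
      1 / 2 * (pd a u y * α b y - pd b u y * α a y) := by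
  have hd := hG.differentiableAt_of_contDiffOn hu hy
  simp only [skewCovForm, covForm, pd_mul hd (hα _), hc a b, hG.christoffel_symm hy _ a b]
  ring

/-- In the trace, the two delta terms of the connection change give -2Υ^bα_b and the metric term
gives +nΥ^bα_b. -/
lemma divForm_rescale [NeZero n] (hu : ContDiffOn ℝ ∞ u S) (hy : y ∈ S) :
    divForm (ConformalQ.rescale u G) α y = divForm G α y
      + (n - 2) * ∑ b, ∑ c, confInv G y b c * (pd b u y * α c y) := by
  set N := ∑ b, ∑ c, (G y)⁻¹ b c * (pd b u y * α c y) with hN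
  have h1 (c b : Fin n) : covForm (ConformalQ.rescale u G) α c b y = covForm G α c b y
      - (pd c u y * α b y + pd b u y * α c y - N * G y b c) := by
    have : ∑ k, (∑ d, (G y)⁻¹ k d * pd d u y) * G y c b * α k y = N * G y b c := by
      rw [hN, Finset.sum_comm, hG.symm hy c b]
      simp only [Finset.sum_mul]
      refine Finset.sum_congr rfl fun k _ ↦ Finset.sum_congr rfl fun d _ ↦ ?_
      rw [hG.inv_symm hy k d]
      ring
    simp only [covForm, hG.christoffel_rescale hu hy, add_mul, sub_mul, Finset.sum_add_distrib,
      Finset.sum_sub_distrib, ite_mul, zero_mul, Finset.sum_ite_eq', Finset.mem_univ, if_true, this]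
    ring
  have h2 : ∑ b, ∑ c, confInv G y b c * (N * G y b c) = N * ((scale G y ^ 2)⁻¹ * n) := by
    rw [← hG.sum_sum_inv_mul hy, ← hG.sum_confInv_mul hy fun a b ↦ G y a b]
    simp only [mul_left_comm _ N, Finset.mul_sum]
  have h3 : ∑ b, ∑ c, confInv G y b c * (pd c u y * α b y) =
      ∑ b, ∑ c, confInv G y b c * (pd b u y * α c y) := by
    rw [Finset.sum_comm]
    simp only [hG.confInv_symm hy]
  simp only [divForm, hG.confInv_rescale hy, h1, mul_sub, mul_add, Finset.sum_add_distrib,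
    Finset.sum_sub_distrib, h2, h3]
  rw [hG.sum_confInv_mul hy fun b c ↦ pd b u y * α c y]
  ring

/-- The connection change has trace nΥ_a, and a density of weight w sees w/n of it. -/
lemma covDensity_rescale (hu : ContDiffOn ℝ ∞ u S) (hy : y ∈ S) (w : ℝ) (f : Model n → ℝ)
    (a : Fin n) : covDensity (ConformalQ.rescale u G) w f a y =
      covDensity G w f a y + w * pd a u y * f y := by
  have hn : (n : ℝ) ≠ 0 := Nat.cast_ne_zero.2 (Fin.pos a).ne'
  have : ∑ b, christoffel (ConformalQ.rescale u G) b a b y =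
      ∑ b, christoffel G b a b y + n * pd a u y := by
    simp only [hG.christoffel_rescale hu hy, Finset.sum_add_distrib, Finset.sum_sub_distrib,
      hG.symm hy a, hG.sum_grad_mul hy]
    simp
  rw [covDensity, covDensity, this]
  field_simp
  ring

lemma differentiableAt_divForm (hα : ∀ b, ContDiffOn ℝ ∞ (α b) S) (hy : y ∈ S) :
    DifferentiableAt ℝ (divForm G α) y := by
  refine hG.differentiableAt_of_contDiffOn (ContDiffOn.sum fun b _ ↦ ContDiffOn.sum fun c _ ↦
    (hG.contDiffOn_confInv b c).mul ((contDiffOn_pd hG.isOpen (hα b) c).sub ?_)) hy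
  exact ContDiffOn.sum fun d _ ↦ (hG.contDiffOn_christoffel d c b).mul (hα d)

lemma covForm_symm (hc : ∀ a b, pd a (α b) y = pd b (α a) y) (hy : y ∈ S) (a b : Fin n) :
    covForm G α a b y = covForm G α b a y := by
  simp only [covForm, hc a b, hG.christoffel_symm hy _ a b]

/-- The divergence of `∇_{[a} (u α_{b]})` for a closed 1-form `α`. -/
lemma divTwoTensor_skewCovForm (hu : ContDiffOn ℝ ∞ u S) (hα : ∀ b, ContDiffOn ℝ ∞ (α b) S)
    (hc : ∀ z ∈ S, ∀ a b, pd a (α b) z = pd b (α a) z) (hy : y ∈ S) (a : Fin n) :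
    2 * divTwoTensor G (skewCovForm G fun b z ↦ u z * α b z) a y =
      ∑ b, ∑ c, confInv G y b c * (covForm G (fun b ↦ pd b u) c a y * α b y)
      + pd a u y * divForm G α y
      - (∑ b, ∑ c, confInv G y b c * covForm G (fun b ↦ pd b u) b c y) * α a y
      - ∑ b, ∑ c, confInv G y b c * (pd b u y * covForm G α a c y) := by
  have hd (z : Model n) (hz : z ∈ S) (b : Fin n) := hG.differentiableAt_of_contDiffOn (hα b) hz
  have h (c b : Fin n) : covTwoTensor G (skewCovForm G fun b z ↦ u z * α b z) c a b y =
      1 / 2 * (covForm G (fun b ↦ pd b u) c a y * α b y + pd a u y * covForm G α c b y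
        - covForm G (fun b ↦ pd b u) b c y * α a y - pd b u y * covForm G α a c y) := by
    -- The formula for the skew part holds on all of S, so it may be differentiated; closedness then
    -- swaps the indices of ∇α and symmetry those of the Hessian.
    rw [covTwoTensor_congr hG.isOpen
      (fun a b z hz ↦ hG.skewCovForm_mul (hd z hz) hu hz (hc z hz) a b) hy,
      covTwoTensor_skew (hG.differentiableAt_pd hu hy) (hd y hy), hG.covForm_symm (hc y hy) hy c a,
      hG.covForm_pd_symm hu hy c b]
  simp only [divTwoTensor, divForm, h, Finset.mul_sum, Finset.sum_mul]
  simp only [← Finset.sum_add_distrib, ← Finset.sum_sub_distrib]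
  exact Finset.sum_congr rfl fun b _ ↦ Finset.sum_congr rfl fun c _ ↦ by ring

end IsMetricOn

/-- The conformal variation of `Q₁` on closed 1-forms, in coordinates. -/
theorem qOne_rescale {S : Set (Model 4)} {G : Model 4 → Matrix (Fin 4) (Fin 4) ℝ}
    (hG : IsMetricOn G S) {u : Model 4 → ℝ} (hu : ContDiffOn ℝ ∞ u S)
    {α : Fin 4 → Model 4 → ℝ} (hα : ∀ b, ContDiffOn ℝ ∞ (α b) S)
    (hc : ∀ z ∈ S, ∀ a b, pd a (α b) z = pd b (α a) z) {y : Model 4} (hy : y ∈ S) (a : Fin 4) :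
    qOne (rescale u G) α a y =
      qOne G α a y + 4 * divTwoTensor G (skewCovForm G fun b z ↦ u z * α b z) a y := by
  have hdα (b : Fin 4) := hG.differentiableAt_of_contDiffOn (hα b) hy
  have hdu := hG.differentiableAt_pd hu hy
  have hdiv : ∀ z ∈ S, divForm (rescale u G) α z = divForm G α z
      + 2 * ∑ b, ∑ c, confInv G z b c * (pd b u z * α c z) := fun z hz ↦ by
    rw [hG.divForm_rescale hu hz]
    norm_num
  have hdi : DifferentiableAt ℝ
      (fun z ↦ ∑ b, ∑ c, confInv G z b c * (pd b u z * α c z)) y :=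
    DifferentiableAt.fun_sum fun b _ ↦ DifferentiableAt.fun_sum fun c _ ↦
      (hG.differentiableAt_confInv hy b c).fun_mul ((hdu b).fun_mul (hdα c))
  have hsym : ∑ b, ∑ c, confInv G y b c * (covForm G (fun b ↦ pd b u) a b y * α c y) =
      ∑ b, ∑ c, confInv G y b c * (covForm G (fun b ↦ pd b u) c a y * α b y) := by
    rw [Finset.sum_comm]
    refine Finset.sum_congr rfl fun b _ ↦ Finset.sum_congr rfl fun c _ ↦ ?_
    rw [hG.confInv_symm hy, hG.covForm_pd_symm hu hy]
  rw [qOne, qOne, hG.covDensity_rescale hu hy, covDensity_congr hG.isOpen hdiv hy, hdiv y hy,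
    covDensity_add (hG.differentiableAt_divForm hα hy) (hdi.const_mul 2),
    covDensity_const_mul hdi, hG.covDensity_inner hdu hdα hy, hsym, hG.confInv_rescale hy,
    hG.sum_schouten_rescale hu (by norm_num) hy fun b ↦ α b y,
    hG.schoutenTrace_rescale hu (by norm_num) hy]
  push_cast
  -- The quadratic terms cancel here because n = 4. The Hessian paired with α has coefficient 4 from
  -- P and -2 from the derivative of Υ^bα_b; the net 2 matches the other linear terms.
  linear_combination -2 * hG.divTwoTensor_skewCovForm hu hα hc hy a

end Forms

end ConformalQ

end

theorem proposition3p1 {M : Type*} [TopologicalSpace M] [ChartedSpace (ConformalQ.Model 4) M]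
    [IsManifold (𝓡 4) ∞ M] (g : ConformalQ.Metric 4 M) (Υ : C^∞⟮𝓡 4, M; ℝ⟯)
    (v : ConformalQ.OneForm 4 M) (hv : v.IsClosed)
    (φ : OpenPartialHomeomorph M (ConformalQ.Model 4))
    (hφ : φ ∈ IsManifold.maximalAtlas (𝓡 4) ∞ M)
    (y : ConformalQ.Model 4) (hy : y ∈ φ.target) (a : Fin 4) :
    ConformalQ.Q₁ (ConformalQ.conformalChange g Υ) v φ a y =
      ConformalQ.Q₁ g v φ a y + 4 * ConformalQ.divSkew g Υ v φ a y := by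
  have hG : ConformalQ.IsMetricOn (ConformalQ.metricComp φ g) φ.target :=
    ⟨φ.open_target, ConformalQ.contDiffOn_metricComp hφ g,
      fun _ hz ↦ ConformalQ.metricComp_posDef hφ g hz⟩
  have hr : ConformalQ.metricComp φ (ConformalQ.conformalChange g Υ) =
      ConformalQ.rescale (fun z ↦ Υ (φ.symm z)) (ConformalQ.metricComp φ g) :=
    funext (ConformalQ.metricComp_conformalChange φ g Υ)
  rw [ConformalQ.Q₁, hr]
  exact ConformalQ.qOne_rescale hG (ConformalQ.contDiffOn_comp_symm hφ Υ)
    (ConformalQ.contDiffOn_formComp hφ v) (hv φ hφ) hy a
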